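/- Let $\mathbb{K}=\mathbb{R}$ or $\mathbb{C}$, let $n\ge 1$, and let $\mathrm{M}_n=\mathrm{M}_n(\mathbb{K})$ be the $\mathbb{K}$-algebra of $n\times n$ matrices over $\mathbb{K}$. For an abelian group $(\Gamma,+)$ and a bilinear (i.e. biadditive) map $\langle\,,\,\rangle:\Gamma\times\Gamma\to\mathbb{Z}/2\mathbb{Z}$, a $\mathbb{K}$-algebra $\mathcal{A}$ is called $\Gamma$-commutative if it is equipped with a decomposition into linear subspaces $\mathcal{A}=\bigoplus_{\gamma\in\Gamma}\mathcal{A}_\gamma$ such that $\mathcal{A}_\gamma\cdot\mathcal{A}_{\gamma'}\subset\mathcal{A}_{\gamma+\gamma'}$ for all $\gamma,\gamma'\in\Gamma$, and $$a\,b=(-1)^{\langle\gamma,\gamma'\rangle}\,b\,a\qquad\text{for all }\gamma,\gamma'\in\Gamma,\ a\in\mathcal{A}_\gamma,\ b\in\mathcal{A}_{\gamma'}.$$ Then there exist an abelian group $\Gamma$, a bilinear map $\langle\,,\,\rangle:\Gamma\times\Gamma\to\mathbb{Z}/2\mathbb{Z}$ and a $\Gamma$-grading of $\mathrm{M}_n$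 making it a $\Gamma$-commutative algebra if and only if $n=2^m$ for some integer $m\ge 0$. -/

import Mathlib

/-- `𝒜` is a `Γ`-grading of the (not necessarily unital or associative) `K`-algebra `A`:
`A = ⨁ γ, 𝒜 γ` as a vector space and `𝒜 γ * 𝒜 δ ⊆ 𝒜 (γ + δ)`. -/
structure IsAlgGrading {K Γ A : Type*} [Field K] [AddCommGroup Γ]
    [NonUnitalNonAssocRing A] [Module K A] (𝒜 : Γ → Submodule K A) : Prop where
  isInternal : open Classical in DirectSum.IsInternal 𝒜
  mul_mem : ∀ (γ δ : Γ) (a b : A), a ∈ 𝒜 γ → b ∈ 𝒜 δ → a * b ∈ 𝒜 (γ + δ)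

/-- The algebra `A`, graded by `𝒜`, is `Γ`-commutative with respect to the bilinear map
`β : Γ × Γ → ℤ/2ℤ`: homogeneous elements satisfy `a b = (-1)^{β(deg a, deg b)} b a`. -/
structure IsGradedCommutative {K Γ A : Type*} [Field K] [AddCommGroup Γ]
    [NonUnitalNonAssocRing A] [Module K A] (β : Γ →+ Γ →+ ZMod 2)
    (𝒜 : Γ → Submodule K A) : Prop extends IsAlgGrading 𝒜 where
  comm : ∀ (γ δ : Γ) (a b : A), a ∈ 𝒜 γ → b ∈ 𝒜 δ →
    a * b = (-1 : K) ^ (β γ δ).val • (b * a)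

/-! Necessity: a nonzero homogeneous matrix is never a left zero divisor, because moving it past
homogeneous factors only costs signs and the matrix algebra is prime (`mul_ne_zero`). Products of
two elements of equal degree are scalar (`exists_mul_eq_smul_one`). Hence each component has
dimension at most one (`le_span_singleton`), and the occurring degrees form a group of exponent
dividing 2 and of order n², so n divides a power of 2.

Sufficiency: for n = 2^m the Pauli matrices, indexed by pairs of vectors over ℤ/2, form a basis that
multiplies and commutes up to sign. -/

section Necessity

variable {K Γ ι : Type*} [Field K] [AddCommGroup Γ] [Fintype ι] [DecidableEq ι]

/-- Matrix algebras over a field are prime rings. -/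
theorem Matrix.eq_zero_or_eq_zero_of_forall_mul_mul_eq_zero {a x : Matrix ι ι K}
    (h : ∀ y, a * y * x = 0) : a = 0 ∨ x = 0 := by
  by_contra! hne
  obtain ⟨ha, hx⟩ := hne
  obtain ⟨i, j, hij⟩ : ∃ i j, a i j ≠ 0 := by
    by_contra! h0
    exact ha (Matrix.ext h0)
  obtain ⟨k, l, hkl⟩ : ∃ k l, x k l ≠ 0 := by
    by_contra! h0
    exact hx (Matrix.ext h0)
  have h1 := congrFun (congrFun (h (Matrix.single j k 1)) i) l
  rw [Matrix.mul_apply, Finset.sum_eq_single k] at h1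
  · simp [hij, hkl] at h1
  · intro b _ hb
    simp [hb]
  · simp

namespace IsAlgGrading

variable {A : Type*} [NonUnitalNonAssocRing A] [Module K A] {𝒜 : Γ → Submodule K A}

theorem iSup_eq_top (h : IsAlgGrading 𝒜) : iSup 𝒜 = ⊤ := by
  classical
  exact DirectSum.IsInternal.submodule_iSup_eq_top (by convert h.isInternal)

theorem iSupIndep (h : IsAlgGrading 𝒜) : iSupIndep 𝒜 := by
  classical
  exact DirectSum.IsInternal.submodule_iSupIndep (by convert h.isInternal)

theorem degree_unique (h : IsAlgGrading 𝒜) {γ δ : Γ} {a : A} (ha : a ≠ 0)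
    (hγ : a ∈ 𝒜 γ) (hδ : a ∈ 𝒜 δ) : γ = δ := by
  by_contra hne
  exact ha (Submodule.disjoint_def.1 (h.iSupIndep.pairwiseDisjoint hne) a hγ hδ)

theorem induction_homogeneous (h : IsAlgGrading 𝒜) {p : A → Prop} (a : A)
    (hom : ∀ γ, ∀ b ∈ 𝒜 γ, p b) (add : ∀ b c, p b → p c → p (b + c)) : p a :=
  Submodule.iSup_induction 𝒜 (motive := p) (h.iSup_eq_top.ge Submodule.mem_top) hom
    (hom 0 0 (zero_mem _)) add

end IsAlgGrading

namespace IsGradedCommutative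

variable {β : Γ →+ Γ →+ ZMod 2} {𝒜 : Γ → Submodule K (Matrix ι ι K)}

/-- If `a * x = 0`, then `a * b * x = ± b * a * x = 0` for every homogeneous `b`, hence for every
matrix, and primality applies. -/
theorem mul_ne_zero (h : IsGradedCommutative β 𝒜) {γ : Γ} {a x : Matrix ι ι K}
    (ha : a ∈ 𝒜 γ) (ha0 : a ≠ 0) (hx0 : x ≠ 0) : a * x ≠ 0 := by
  intro hax
  refine (Matrix.eq_zero_or_eq_zero_of_forall_mul_mul_eq_zero fun y ↦ ?_).elim ha0 hx0
  refine h.toIsAlgGrading.induction_homogeneous (p := fun y ↦ a * y * x = 0) y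
    (fun δ b hb ↦ ?_) fun b c hb hc ↦ ?_
  · rw [h.comm γ δ a b ha hb, smul_mul_assoc, mul_assoc, hax, mul_zero, smul_zero]
  · rw [mul_add, add_mul, hb, hc, add_zero]

/-- A degree in the radical of `β` produces no signs, so `a` is central. -/
theorem exists_eq_smul_one (h : IsGradedCommutative β 𝒜) {γ : Γ} (hγ : β γ = 0)
    {a : Matrix ι ι K} (ha : a ∈ 𝒜 γ) : ∃ c : K, a = c • 1 := by
  have hcomm : ∀ y, y * a = a * y := fun y ↦ by
    refine h.toIsAlgGrading.induction_homogeneous (p := fun y ↦ y * a = a * y) y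
      (fun δ b hb ↦ ?_) fun b c hb hc ↦ ?_
    · rw [h.comm γ δ a b ha hb]
      simp [hγ]
    · rw [mul_add, add_mul, hb, hc]
  obtain ⟨c, hc⟩ := Matrix.mem_range_scalar_of_commute_single
    (M := a) fun i j _ ↦ hcomm (Matrix.single i j 1)
  exact ⟨c, by rw [← hc, Matrix.smul_one_eq_diagonal]; rfl⟩

theorem exists_mul_eq_smul_one (h : IsGradedCommutative β 𝒜) {γ : Γ} {a b : Matrix ι ι K}
    (ha : a ∈ 𝒜 γ) (hb : b ∈ 𝒜 γ) : ∃ c : K, a * b = c • 1 :=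
  h.exists_eq_smul_one (by rw [map_add]; ext δ; exact CharTwo.add_self_eq_zero _)
    (h.mul_mem γ γ a b ha hb)

theorem add_self_eq_zero (h : IsGradedCommutative β 𝒜) {γ : Γ} {a : Matrix ι ι K}
    (ha : a ∈ 𝒜 γ) (ha0 : a ≠ 0) : γ + γ = 0 := by
  obtain ⟨c, hc⟩ := h.exists_mul_eq_smul_one ha ha
  have hne := h.mul_ne_zero ha ha0 ha0
  have hc0 : c ≠ 0 := by
    rintro rfl
    exact hne (by rw [hc, zero_smul])
  have h1 : (1 : Matrix ι ι K) ∈ 𝒜 (γ + γ) :=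
    ((𝒜 (γ + γ)).smul_mem_iff hc0).1 (hc ▸ h.mul_mem γ γ a a ha ha)
  have h10 : (1 : Matrix ι ι K) ≠ 0 := by
    intro h0
    exact hne (by rw [hc, h0, smul_zero])
  -- Since `1 * 1 = 1`, the degree `γ + γ` of `1` equals its own double, so it vanishes.
  have h2 := h.mul_mem _ _ _ _ h1 h1
  rw [one_mul] at h2
  exact add_eq_left.1 (h.degree_unique h10 h1 h2).symm

theorem le_span_singleton (h : IsGradedCommutative β 𝒜) {γ : Γ} {a : Matrix ι ι K}
    (ha : a ∈ 𝒜 γ) (ha0 : a ≠ 0) : 𝒜 γ ≤ K ∙ a := by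
  intro b hb
  obtain ⟨c, hc⟩ := h.exists_mul_eq_smul_one ha ha
  obtain ⟨d, hd⟩ := h.exists_mul_eq_smul_one ha hb
  have hc0 : c ≠ 0 := by
    rintro rfl
    exact h.mul_ne_zero ha ha0 ha0 (by rw [hc, zero_smul])
  -- Left multiplication by `a` sends this difference to `c d - d c = 0`, and `a` can be cancelled.
  have key : c • b - d • a = 0 := by
    by_contra hne
    refine h.mul_ne_zero ha ha0 hne ?_
    rw [mul_sub, mul_smul_comm, mul_smul_comm, hc, hd, smul_smul, smul_smul, mul_comm, sub_self]
  refine Submodule.mem_span_singleton.2 ⟨c⁻¹ * d, ?_⟩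
  rw [mul_smul, ← sub_eq_zero.1 key, inv_smul_smul₀ hc0]

/-- The degrees occurring in a graded commutative matrix algebra form a group. -/
def support [Nonempty ι] (h : IsGradedCommutative β 𝒜) : AddSubgroup Γ where
  carrier := {γ | ∃ a ∈ 𝒜 γ, a ≠ 0}
  add_mem' := by
    rintro γ δ ⟨a, ha, ha0⟩ ⟨b, hb, hb0⟩
    exact ⟨a * b, h.mul_mem _ _ _ _ ha hb, h.mul_ne_zero ha ha0 hb0⟩
  zero_mem' := by
    obtain ⟨γ, hγ⟩ : ∃ γ, 𝒜 γ ≠ ⊥ := by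
      by_contra! hbot
      have := h.toIsAlgGrading.iSup_eq_top
      rw [iSup_eq_bot.2 hbot] at this
      exact bot_ne_top this
    obtain ⟨a, ha, ha0⟩ := (Submodule.ne_bot_iff _).1 hγ
    refine ⟨a * a, ?_, h.mul_ne_zero ha ha0 ha0⟩
    exact h.add_self_eq_zero ha ha0 ▸ h.mul_mem _ _ _ _ ha ha
  neg_mem' := by
    rintro γ ⟨a, ha, ha0⟩
    exact ⟨a, by rwa [neg_eq_of_add_eq_zero_left (h.add_self_eq_zero ha ha0)], ha0⟩

theorem exists_card_eq_two_pow [Nonempty ι] (h : IsGradedCommutative β 𝒜) :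
    ∃ m : ℕ, Fintype.card ι = 2 ^ m := by
  choose e he he0 using fun γ : h.support ↦ γ.2
  have hli : LinearIndependent K e :=
    (h.toIsAlgGrading.iSupIndep.comp Subtype.val_injective).linearIndependent _ he he0
  have hspan : ⊤ ≤ Submodule.span K (Set.range e) := by
    rw [← h.toIsAlgGrading.iSup_eq_top, iSup_le_iff]
    intro γ
    by_cases hγ : γ ∈ h.support
    · exact (h.le_span_singleton (he ⟨γ, hγ⟩) (he0 ⟨γ, hγ⟩)).trans
        (Submodule.span_mono (Set.singleton_subset_iff.2 ⟨_, rfl⟩))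
    · intro a ha
      have : a = 0 := by
        by_contra ha0
        exact hγ ⟨a, ha, ha0⟩
      exact this ▸ zero_mem _
  let b := Module.Basis.mk hli hspan
  have : Finite h.support := Module.Finite.finite_basis b
  have hcard : Fintype.card ι * Fintype.card ι = Nat.card h.support := by
    rw [← Module.finrank_eq_nat_card_basis b, Module.finrank_matrix, Module.finrank_self, mul_one]
  have hp : IsPGroup 2 (Multiplicative h.support) := fun γ ↦ ⟨1, by
    obtain ⟨a, ha, ha0⟩ := γ.toAdd.2
    rw [pow_one, pow_two]
    exact Multiplicative.toAdd.injective (Subtype.ext (h.add_self_eq_zero ha ha0))⟩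
  obtain ⟨k, hk⟩ := IsPGroup.iff_card.1 hp
  obtain ⟨m, -, hm⟩ := (Nat.dvd_prime_pow Nat.prime_two).1
    (Dvd.intro _ (hcard.trans hk) : Fintype.card ι ∣ 2 ^ k)
  exact ⟨m, hm⟩

end IsGradedCommutative

end Necessity

section Construction

theorem isGradedCommutative_span_singleton {K Γ A : Type*} [Field K] [AddCommGroup Γ] [Ring A]
    [Algebra K A] {β : Γ →+ Γ →+ ZMod 2} {s : Γ → Γ → K} {e : Γ → A}
    (hli : LinearIndependent K e) (hspan : Submodule.span K (Set.range e) = ⊤)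
    (hmul : ∀ γ δ, e γ * e δ = s γ δ • e (γ + δ))
    (hcomm : ∀ γ δ, e γ * e δ = (-1 : K) ^ (β γ δ).val • (e δ * e γ)) :
    IsGradedCommutative β fun γ ↦ K ∙ e γ where
  isInternal := by
    classical
    refine DirectSum.isInternal_submodule_of_iSupIndep_of_iSup_eq_top
      hli.iSupIndep_span_singleton ?_
    rw [← Submodule.span_range_eq_iSup, hspan]
  mul_mem γ δ a b ha hb := by
    obtain ⟨c, rfl⟩ := Submodule.mem_span_singleton.1 ha
    obtain ⟨d, rfl⟩ := Submodule.mem_span_singleton.1 hb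
    rw [smul_mul_smul_comm, hmul]
    exact Submodule.smul_mem _ _ (Submodule.smul_mem _ _ (Submodule.mem_span_singleton_self _))
  comm γ δ a b ha hb := by
    obtain ⟨c, rfl⟩ := Submodule.mem_span_singleton.1 ha
    obtain ⟨d, rfl⟩ := Submodule.mem_span_singleton.1 hb
    rw [smul_mul_smul_comm, smul_mul_smul_comm, hcomm, smul_comm, mul_comm c d]

variable (𝕜 : Type*) [RCLike 𝕜] {V : Type*} [Fintype V]

/-- The nontrivial character of `ZMod 2`. -/
def signChar : AddChar (ZMod 2) 𝕜 where
  toFun t := (-1) ^ t.val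
  map_zero_eq_one' := by simp
  map_add_eq_mul' s t := by
    rw [ZMod.val_add, ← pow_add, ← neg_one_pow_eq_pow_mod_two]

theorem signChar_apply (t : ZMod 2) : signChar 𝕜 t = (-1) ^ t.val := rfl

theorem signChar_injective : Function.Injective (signChar 𝕜) := by
  have h : signChar 𝕜 1 ≠ signChar 𝕜 0 := by
    rw [signChar_apply, signChar_apply]
    norm_num [ZMod.val_one]
  intro s t hst
  fin_cases s <;> fin_cases t <;> first | rfl | exact absurd hst h | exact absurd hst h.symm

/-- The character `x ↦ (-1)^(b ⬝ x)` of `V → ZMod 2`. -/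
def dotChar (b : V → ZMod 2) : AddChar (V → ZMod 2) 𝕜 where
  toFun x := signChar 𝕜 (b ⬝ᵥ x)
  map_zero_eq_one' := by simp
  map_add_eq_mul' x y := by rw [dotProduct_add, AddChar.map_add_eq_mul]

theorem dotChar_apply (b x : V → ZMod 2) : dotChar 𝕜 b x = signChar 𝕜 (b ⬝ᵥ x) := rfl

theorem dotChar_injective : Function.Injective (dotChar 𝕜 : (V → ZMod 2) → _) := by
  classical
  intro b c h
  ext i
  have := signChar_injective 𝕜 (DFunLike.congr_fun h (Pi.single i 1))
  simpa using this

/-- The commutation form `⟨(a, b), (c, d)⟩ = b ⬝ c + a ⬝ d` of the Pauli matrices. -/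
def pauliForm (V : Type*) [Fintype V] :
    (V → ZMod 2) × (V → ZMod 2) →+ (V → ZMod 2) × (V → ZMod 2) →+ ZMod 2 :=
  AddMonoidHom.mk' (fun γ ↦ AddMonoidHom.mk' (fun δ ↦ γ.2 ⬝ᵥ δ.1 + γ.1 ⬝ᵥ δ.2) fun δ ε ↦ by
      simp only [Prod.fst_add, Prod.snd_add, dotProduct_add]
      abel)
    fun γ δ ↦ by
      refine DFunLike.ext _ _ fun ε ↦ ?_
      simp only [AddMonoidHom.mk'_apply, AddMonoidHom.add_apply, Prod.fst_add, Prod.snd_add,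
        add_dotProduct]
      abel

theorem pauliForm_apply (γ δ : (V → ZMod 2) × (V → ZMod 2)) :
    pauliForm V γ δ = γ.2 ⬝ᵥ δ.1 + γ.1 ⬝ᵥ δ.2 := rfl

/-- The generalized Pauli matrix: translation by `γ.1` after multiplication by the
character of `γ.2`. -/
def pauli [DecidableEq V] (γ : (V → ZMod 2) × (V → ZMod 2)) :
    Matrix (V → ZMod 2) (V → ZMod 2) 𝕜 :=
  Matrix.of fun i j ↦ if i = j + γ.1 then dotChar 𝕜 γ.2 j else 0

variable [DecidableEq V]

theorem pauli_apply (γ : (V → ZMod 2) × (V → ZMod 2)) (i j : V → ZMod 2) :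
    pauli 𝕜 γ i j = if i = j + γ.1 then dotChar 𝕜 γ.2 j else 0 := rfl

theorem pauli_mul (γ δ : (V → ZMod 2) × (V → ZMod 2)) :
    pauli 𝕜 γ * pauli 𝕜 δ = signChar 𝕜 (γ.2 ⬝ᵥ δ.1) • pauli 𝕜 (γ + δ) := by
  ext i j
  rw [Matrix.mul_apply, Finset.sum_eq_single (j + δ.1)]
  · simp only [pauli_apply, Matrix.smul_apply, smul_eq_mul, if_true, Prod.fst_add, Prod.snd_add,
      add_assoc, add_comm δ.1 γ.1]
    split_ifs
    · simp only [dotChar_apply, add_dotProduct, AddChar.map_add_eq_mul]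
      ring
    · simp
  · intro k _ hk
    simp [pauli_apply, hk]
  · simp

theorem linearIndependent_pauli : LinearIndependent 𝕜 (pauli 𝕜 (V := V)) := by
  rw [Fintype.linearIndependent_iff]
  rintro g hg ⟨a, b⟩
  have hli := (AddChar.linearIndependent (V → ZMod 2) 𝕜).comp _ (dotChar_injective 𝕜 (V := V))
  -- The entry at `(j + a, j)` only sees the indices with first component `a`, which leaves a
  -- relation between distinct characters evaluated at `j`.
  refine Fintype.linearIndependent_iff.1 hli (fun b ↦ g (a, b)) (funext fun j ↦ ?_) b
  have := congrFun (congrFun hg (j + a)) j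
  simpa [Matrix.sum_apply, Fintype.sum_prod_type, pauli_apply, Finset.sum_apply,
    Finset.sum_ite_eq, Finset.sum_comm (γ := V → ZMod 2)] using this

theorem pauli_mul_comm (γ δ : (V → ZMod 2) × (V → ZMod 2)) :
    pauli 𝕜 γ * pauli 𝕜 δ = (-1 : 𝕜) ^ (pauliForm V γ δ).val • (pauli 𝕜 δ * pauli 𝕜 γ) := by
  rw [← signChar_apply, pauli_mul, pauli_mul, smul_smul, add_comm δ γ, pauliForm_apply,
    ← AddChar.map_add_eq_mul, dotProduct_comm γ.1, add_assoc, CharTwo.add_self_eq_zero, add_zero]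

theorem exists_isGradedCommutative_two_pow (m : ℕ) :
    ∃ (Γ : Type*) (_ : AddCommGroup Γ) (β : Γ →+ Γ →+ ZMod 2)
      (𝒜 : Γ → Submodule 𝕜 (Matrix (Fin (2 ^ m)) (Fin (2 ^ m)) 𝕜)),
      IsGradedCommutative β 𝒜 := by
  let G := (Fin m → ZMod 2) × (Fin m → ZMod 2)
  -- The lift places the grading group in an arbitrary universe.
  let f : ULift G ≃+ G := AddEquiv.ulift
  let r : Matrix (Fin m → ZMod 2) (Fin m → ZMod 2) 𝕜 ≃ₐ[𝕜] _ :=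
    Matrix.reindexAlgEquiv 𝕜 𝕜 (Fintype.equivFinOfCardEq (n := 2 ^ m) (by simp [ZMod.card]))
  let e : ULift G → Matrix (Fin (2 ^ m)) (Fin (2 ^ m)) 𝕜 := fun γ ↦ r (pauli 𝕜 (f γ))
  have hli : LinearIndependent 𝕜 e :=
    ((linearIndependent_pauli 𝕜).comp f f.injective).map' r.toLinearMap
      (LinearMap.ker_eq_bot.2 r.injective)
  refine ⟨ULift G, inferInstance, ((pauliForm (Fin m)).compl₂ f.toAddMonoidHom).comp f.toAddMonoidHom, _,
    isGradedCommutative_span_singleton (s := fun γ δ ↦ signChar 𝕜 ((f γ).2 ⬝ᵥ (f δ).1))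
      hli ?_ (fun γ δ ↦ ?_) fun γ δ ↦ ?_⟩
  · refine hli.span_eq_top_of_card_eq_finrank' ?_
    rw [Module.finrank_matrix, Module.finrank_self, mul_one]
    simp [G, ZMod.card]
  · rw [← map_mul, pauli_mul, map_smul, ← map_add]
  · rw [← map_mul, ← map_mul, pauli_mul_comm, map_smul]
    rfl

end Construction

theorem mainTheorem1 (𝕜 : Type*) [RCLike 𝕜] (n : ℕ) (hn : 0 < n) :
    (∃ (Γ : Type*) (_ : AddCommGroup Γ) (β : Γ →+ Γ →+ ZMod 2)
        (𝒜 : Γ → Submodule 𝕜 (Matrix (Fin n) (Fin n) 𝕜)), IsGradedCommutative β 𝒜) ↔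
      ∃ m : ℕ, n = 2 ^ m := by
  constructor
  · rintro ⟨Γ, _, β, 𝒜, h⟩
    have : Nonempty (Fin n) := ⟨⟨0, hn⟩⟩
    simpa using h.exists_card_eq_two_pow
  · rintro ⟨m, rfl⟩
    exact exists_isGradedCommutative_two_pow 𝕜 m
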